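/- Let $p\ge 2$ be an integer. For $n\ge 0$ let $N(p,n)$ denote the maximal number of linearly independent harmonic homogeneous polynomials of degree $n$ in $p$ real variables, i.e. the dimension of the real vector space of all real polynomials $H(x_1,\dots,x_p)$, homogeneous of degree $n$, with $\sum_{i=1}^p \partial^2 H/\partial x_i^2=0$. Let $\eta=(1,0,\dots,0)\in\mathbb{R}^p$. Then for every $n\ge 0$ there is a unique real polynomial $P_n$ in one variable (the Legendre polynomial of degree $n$ in $p$ dimensions) with the following property: there is a harmonic homogeneous polynomial $L_n$ of degree $n$ in $p$ variables such that $L_n(\eta)=1$, $L_n(Rx)=L_n(x)$ for all $x\in\mathbb{R}^p$ and all orthogonal $p\times p$ matrices $R$ with $R\eta=\eta$, and $L_n(\xi)=P_n(\langle\xi,\eta\rangle)$ for all unit vectors $\xi\in\mathbb{R}^p$. Moreover, for all real $r,t$ with $|r|<1$ and $-1\le t\le 1$, the following series converges absolutely and $$\sum_{n=0}^\infty r^n N(p,n) P_n(t)=\frac{1-r^2}{(1-2rt+r^2)^{p/2}}.$$ -/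

import Mathlib

/-- The Laplace operator `∑ᵢ ∂²/∂xᵢ²` on real polynomials in `p` variables. -/
noncomputable def polyLaplacian (p : ℕ) :
    MvPolynomial (Fin p) ℝ →ₗ[ℝ] MvPolynomial (Fin p) ℝ :=
  ∑ i : Fin p, (MvPolynomial.pderiv i).toLinearMap ∘ₗ (MvPolynomial.pderiv i).toLinearMap

/-- The real vector space of harmonic homogeneous polynomials of degree `n` in `p` variables
(the zero polynomial included). -/
noncomputable def harmonicHomogeneous (p n : ℕ) : Submodule ℝ (MvPolynomial (Fin p) ℝ) :=
  MvPolynomial.homogeneousSubmodule (Fin p) ℝ n ⊓ LinearMap.ker (polyLaplacian p)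

/-- `N(p,n)`: the maximal number of linearly independent harmonic homogeneous polynomials of
degree `n` in `p` variables. -/
noncomputable def harmonicDim (p n : ℕ) : ℕ :=
  Module.finrank ℝ (harmonicHomogeneous p n)

/-- The vector `η = (1, 0, …, 0)` of `ℝ^p`. -/
def northPole (p : ℕ) : Fin p → ℝ := fun i => if i.val = 0 then 1 else 0

/-- `L` is a harmonic homogeneous polynomial of degree `n` in `p` variables with `L(η) = 1` that
is invariant under all orthogonal matrices `R` fixing `η`. -/
structure IsZonalHarmonic (p n : ℕ) (L : MvPolynomial (Fin p) ℝ) : Prop where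
  mem : L ∈ harmonicHomogeneous p n
  eval_pole : MvPolynomial.eval (northPole p) L = 1
  invariant : ∀ R ∈ Matrix.orthogonalGroup (Fin p) ℝ,
    R.mulVec (northPole p) = northPole p →
      ∀ x : Fin p → ℝ, MvPolynomial.eval (R.mulVec x) L = MvPolynomial.eval x L

/-- `P` is a polynomial in one variable with `P(⟨ξ, η⟩) = L(ξ)` for all unit vectors `ξ` of `ℝ^p`,
for some `L` as in `IsZonalHarmonic`. -/
def IsLegendrePolynomial (p n : ℕ) (P : Polynomial ℝ) : Prop :=
  ∃ L : MvPolynomial (Fin p) ℝ, IsZonalHarmonic p n L ∧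
    ∀ ξ : Fin p → ℝ, ξ ⬝ᵥ ξ = 1 → MvPolynomial.eval ξ L = P.eval (ξ ⬝ᵥ northPole p)

open Classical in
/-- The Legendre polynomial `P_n` of degree `n` in `p` dimensions: the polynomial satisfying
`IsLegendrePolynomial p n` (the value `0` is used only if there is none). -/
noncomputable def legendrePolynomial (p n : ℕ) : Polynomial ℝ :=
  if h : ∃ P, IsLegendrePolynomial p n P then h.choose else 0

/-!
The proof rests on the Poisson kernel `(1 - |x|² T²) / |η - T x|^p`, treated as a formal power
series in `T` whose coefficients are polynomials in `x` (`poissonSeries`). Here `|η - T x|^(-p)` is the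
`p`-th power of the formal inverse square root of `D = 1 - 2 x₀ T + |x|² T²`.

* Differentiating coefficientwise and using only `S² D = 1` for `S = D^(-1/2)`, one finds that the
  kernel is harmonic in `x` (`polyLaplacian_coeff_poissonSeries`).
* Its `n`-th coefficient `K_n` is homogeneous of degree `n`, invariant under the stabiliser of `η`,
  and on the unit sphere a polynomial in `⟨ξ, η⟩`. These properties hold for the coefficients of `D`
  and pass to products of series and to `D^(-1/2)` (`isZonalSeries_poissonSeries`).
* At `x = η` the kernel is `(1 - T²) / (1 - T)^p`. Since the Laplacian maps homogeneous polynomials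
  of degree `n + 2` onto those of degree `n` (`map_polyLaplacian_homogeneousSubmodule`), the dimension
  `N(p, n)` is a difference of two binomial coefficients, and these differences are the coefficients
  of that series: `K_n(η) = N(p, n)` (`eval_northPole_coeff_poissonSeries`).

So `K_n / N(p, n)` is a zonal harmonic. It is the only one: an invariant polynomial is a polynomial
in `x₀` and `∑_{i ≠ 0} xᵢ²`, and harmonicity determines it recursively from its restriction to the axis
through `η` (`eq_zero_of_eval_northPole_eq_zero`). Hence `N(p, n) P_n(⟨ξ, η⟩) = K_n(ξ)` on the unit
sphere, and the identity to be proved is the statement that the formal Poisson kernel converges to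
its closed form. For this, `(1 - 2 t T + T²)^(-1/2)` is factored over `ℂ` into two conjugate
binomial series with bounded coefficients (`hasAbsSum_of_sq_mul_eq_one`); being a product of conjugates, the
sum is the positive square root, and products of absolutely convergent series give the rest.
-/

/-! ### Derivations and inverse square roots of formal power series -/

open PowerSeries in
/-- A derivation of `A` acting coefficientwise on power series over `A`. -/
noncomputable def PowerSeries.coeffDerivation {R A : Type*} [CommRing R] [CommRing A] [Algebra R A]
    (d : Derivation R A A) : Derivation R A⟦X⟧ A⟦X⟧ :=
  Derivation.mk'
    { toFun := fun f => PowerSeries.mk fun n => d (coeff n f)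
      map_add' := fun f g => by ext n; simp
      map_smul' := fun c f => by ext n; simp }
    fun f g => by
      ext n
      simp only [LinearMap.coe_mk, AddHom.coe_mk, coeff_mk, smul_eq_mul, map_add, coeff_mul,
        map_sum, Derivation.leibniz, Finset.sum_add_distrib]
      congr 1
      rw [← Finset.Nat.sum_antidiagonal_swap]
      rfl

namespace PowerSeries

variable {R A : Type*} [CommRing R] [CommRing A] [Algebra R A]

@[simp]
lemma coeff_coeffDerivation (d : Derivation R A A) (f : A⟦X⟧) (n : ℕ) :
    coeff n (coeffDerivation d f) = d (coeff n f) := by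
  simp [coeffDerivation]

@[simp]
lemma coeffDerivation_C (d : Derivation R A A) (a : A) :
    coeffDerivation d (C a) = C (d a) := by
  ext n
  simp only [coeff_coeffDerivation, coeff_C]
  split_ifs <;> simp

@[simp]
lemma coeffDerivation_X (d : Derivation R A A) :
    coeffDerivation d (X : A⟦X⟧) = 0 := by
  ext n
  simp only [coeff_coeffDerivation, coeff_X]
  split_ifs <;> simp

/-- The formal power series `(1 + f) ^ (-1/2)`, for `f` without constant term. -/
noncomputable def invSqrt [Algebra ℚ A] (f : A⟦X⟧) : A⟦X⟧ :=
  (binomialSeries A (-1 / 2 : ℚ)).subst f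

lemma binomialSeries_neg_half_sq [Algebra ℚ A] :
    binomialSeries A (-1 / 2 : ℚ) ^ 2 * (1 + X) = 1 := by
  have h1 : (1 + X : A⟦X⟧) = binomialSeries A (1 : ℚ) := by
    simpa using (binomialSeries_nat (R := ℚ) (A := A) 1).symm
  rw [h1, sq, ← binomialSeries_add, ← binomialSeries_add]
  norm_num

lemma invSqrt_sq_mul [Algebra ℚ A] {f : A⟦X⟧} (hf : constantCoeff f = 0) :
    invSqrt f ^ 2 * (1 + f) = 1 := by
  have hs : HasSubst f := HasSubst.of_constantCoeff_zero' hf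
  have h := congrArg (substAlgHom (R := A) hs) (binomialSeries_neg_half_sq (A := A))
  simp only [map_mul, map_pow, map_add, map_one, substAlgHom_X] at h
  rwa [coe_substAlgHom] at h

lemma constantCoeff_invSqrt [Algebra ℚ A] {f : A⟦X⟧} (hf : constantCoeff f = 0) :
    constantCoeff (invSqrt f) = 1 := by
  have hs : HasSubst f := HasSubst.of_constantCoeff_zero' hf
  have h : constantCoeff ((binomialSeries A (-1 / 2 : ℚ) - 1).subst f : A⟦X⟧) = 0 :=
    constantCoeff_subst_eq_zero hf _ (by simp)
  rw [subst_sub hs, ← coe_substAlgHom hs, map_one, coe_substAlgHom, map_sub, map_one,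
    sub_eq_zero] at h
  exact h

end PowerSeries

/-! ### The formal Poisson kernel and its harmonicity -/

/-- The polynomial `|x|² = ∑ᵢ xᵢ²`. -/
noncomputable def normSqPoly (p : ℕ) : MvPolynomial (Fin p) ℝ := ∑ i, MvPolynomial.X i ^ 2

open PowerSeries in
/-- The power series `-2 x₀ T + |x|² T²` in `T`, so that `1 + kernelBase p` is `|η - T x|²`. -/
noncomputable def kernelBase (p : ℕ) [NeZero p] : (MvPolynomial (Fin p) ℝ)⟦X⟧ :=
  C (normSqPoly p) * X ^ 2 - C (2 * MvPolynomial.X 0) * X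

open PowerSeries in
/-- The Poisson kernel `(1 - |x|² T²) / |η - T x|^p` as a formal power series in `T`. -/
noncomputable def poissonSeries (p : ℕ) [NeZero p] : (MvPolynomial (Fin p) ℝ)⟦X⟧ :=
  (1 - C (normSqPoly p) * X ^ 2) * invSqrt (kernelBase p) ^ p

section Harmonic

open PowerSeries

lemma pderiv_normSqPoly {p : ℕ} (i : Fin p) :
    MvPolynomial.pderiv i (normSqPoly p) = 2 * MvPolynomial.X i := by
  classical
  simp only [normSqPoly, map_sum, Derivation.leibniz_pow, MvPolynomial.pderiv_X, smul_eq_mul,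
    nsmul_eq_mul]
  rw [Finset.sum_eq_single i]
  · simp
  · intro j _ hj
    simp [hj.symm]
  · simp

lemma polyLaplacian_apply {p : ℕ} (f : MvPolynomial (Fin p) ℝ) :
    polyLaplacian p f = ∑ i, MvPolynomial.pderiv i (MvPolynomial.pderiv i f) := by
  simp [polyLaplacian]

variable {p : ℕ} [NeZero p]

/-- The partial derivative `∂/∂xᵢ` acting coefficientwise on power series in `T`. -/
noncomputable abbrev seriesPderiv (i : Fin p) :
    Derivation ℝ (MvPolynomial (Fin p) ℝ)⟦X⟧ (MvPolynomial (Fin p) ℝ)⟦X⟧ :=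
  coeffDerivation (MvPolynomial.pderiv i)

lemma constantCoeff_kernelBase : constantCoeff (kernelBase p) = 0 := by
  simp [kernelBase]

lemma pderiv_X_zero (i : Fin p) :
    MvPolynomial.pderiv i (MvPolynomial.X 0 : MvPolynomial (Fin p) ℝ) = if i = 0 then 1 else 0 := by
  classical
  simp [MvPolynomial.pderiv_X, Pi.single_apply, eq_comm]

/-- If `S = D^(-1/2)`, so that `S^q = D^(-q/2)`, the second derivative of `E S^q` is expressed
through the derivatives of `D` and `E`, after clearing the denominator `4 D²`. -/
lemma derivation_kernel {R A : Type*} [CommRing R] [CommRing A] [Algebra R A]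
    (d : Derivation R A A) {S D : A} (E : A) (q : ℕ) (h : S ^ 2 * D = 1) :
    4 * D ^ 2 * d (d (E * S ^ q)) = S ^ q * (4 * D ^ 2 * d (d E) - 4 * D * q * (d E * d D)
      + E * ((q + 2) * q * d D ^ 2 - 2 * q * D * d (d D))) := by
  have h1 : 2 * D * d S = - (S * d D) := by
    have := congrArg d h
    simp only [Derivation.leibniz, Derivation.leibniz_pow, smul_eq_mul, Derivation.map_one_eq_zero,
      nsmul_eq_mul] at this
    norm_num at this
    linear_combination S * D * this - (2 * D * d S + S * d D) * h
  have hF : 2 * D * d (S ^ q) = - (q * S ^ q * d D) := by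
    rcases q with _ | q
    · simp
    · simp only [Derivation.leibniz_pow, smul_eq_mul, nsmul_eq_mul, Nat.add_sub_cancel]
      push_cast
      linear_combination (q + 1) * S ^ q * h1
  have hF2 : 2 * d D * d (S ^ q) + 2 * D * d (d (S ^ q)) =
      - (q * d (S ^ q) * d D + q * S ^ q * d (d D)) := by
    have h2 := congrArg d hF
    have hq : d (q : A) = 0 := by simp
    have h2' : d (2 : A) = 0 := by exact_mod_cast d.map_natCast 2
    simp only [Derivation.leibniz, smul_eq_mul, map_neg, hq, h2'] at h2
    linear_combination h2
  simp only [Derivation.leibniz, smul_eq_mul, map_add]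
  linear_combination (4 * D * d E - E * (q + 2) * d D) * hF + 2 * D * E * hF2

/-- The Poisson kernel is annihilated by the Laplacian acting coefficientwise. -/
lemma sum_pderiv_poissonSeries :
    ∑ i, seriesPderiv i (seriesPderiv i (poissonSeries p)) = 0 := by
  set ρ : (MvPolynomial (Fin p) ℝ)⟦X⟧ := C (normSqPoly p) with hρ
  set x : Fin p → (MvPolynomial (Fin p) ℝ)⟦X⟧ := fun i => C (MvPolynomial.X i) with hx
  set S := invSqrt (kernelBase p)
  set D := 1 + kernelBase p with hD
  set T : (MvPolynomial (Fin p) ℝ)⟦X⟧ := X with hT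
  have hDeq : D = 1 - 2 * x 0 * T + ρ * T ^ 2 := by
    simp only [hD, kernelBase, hρ, hx, map_mul, map_ofNat, hT]
    ring
  have hSD : S ^ 2 * D = 1 := invSqrt_sq_mul constantCoeff_kernelBase
  have dT (i : Fin p) : seriesPderiv i T = 0 := coeffDerivation_X _
  have dx0 (i : Fin p) : seriesPderiv i (x 0) = if i = 0 then 1 else 0 := by
    simp only [hx, seriesPderiv, coeffDerivation_C, pderiv_X_zero]
    split_ifs <;> simp
  have dx (i : Fin p) : seriesPderiv i (x i) = 1 := by
    simp [hx]
  have dρ (i : Fin p) : seriesPderiv i ρ = 2 * x i := by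
    simp only [hρ, seriesPderiv, coeffDerivation_C, pderiv_normSqPoly, hx, map_mul, map_ofNat]
  have d2 (i : Fin p) : seriesPderiv i 2 = 0 := by
    exact_mod_cast (seriesPderiv i).map_natCast 2
  have dD (i : Fin p) : seriesPderiv i D = 2 * x i * T ^ 2 - 2 * T * (if i = 0 then 1 else 0) := by
    simp only [hDeq, map_add, map_sub, Derivation.leibniz, Derivation.leibniz_pow, smul_eq_mul,
      dT, dx0, dρ, d2, Derivation.map_one_eq_zero]
    simp
    ring_nf
  have ddD (i : Fin p) : seriesPderiv i (seriesPderiv i D) = 2 * T ^ 2 := by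
    have h0 : seriesPderiv i (if i = 0 then (1 : (MvPolynomial (Fin p) ℝ)⟦X⟧) else 0) = 0 := by
      split_ifs <;> simp
    simp only [dD, map_sub, Derivation.leibniz, Derivation.leibniz_pow, smul_eq_mul,
      dT, dx, d2, h0]
    simp
    ring
  have dE (i : Fin p) : seriesPderiv i (1 - ρ * T ^ 2) = - (2 * x i * T ^ 2) := by
    simp only [map_sub, Derivation.leibniz, Derivation.leibniz_pow, smul_eq_mul,
      dT, dρ, Derivation.map_one_eq_zero]
    simp
    ring
  have ddE (i : Fin p) : seriesPderiv i (seriesPderiv i (1 - ρ * T ^ 2)) = - (2 * T ^ 2) := by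
    simp only [dE, map_neg, Derivation.leibniz, Derivation.leibniz_pow, smul_eq_mul,
      dT, dx, d2]
    simp
    ring
  have hsum : ∑ i, x i ^ 2 = ρ := by
    simp [hx, hρ, normSqPoly]
  -- Power series over a domain form a domain, so the claim may be multiplied by `4 D² ≠ 0`.
  have key : 4 * D ^ 2 * ∑ i, seriesPderiv i (seriesPderiv i (poissonSeries p)) = 0 := by
    rw [Finset.mul_sum]
    have hi (i : Fin p) : 4 * D ^ 2 * seriesPderiv i (seriesPderiv i (poissonSeries p)) =
        S ^ p * (-(8 * D ^ 2 * T ^ 2) + 16 * D * p * T ^ 4 * x i ^ 2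
          - 16 * D * p * T ^ 3 * (if i = 0 then x i else 0)
          + (1 - ρ * T ^ 2) * (4 * (p + 2) * p * (T ^ 4 * x i ^ 2
            - 2 * T ^ 3 * (if i = 0 then x i else 0)
            + T ^ 2 * (if i = 0 then 1 else 0)) - 4 * p * D * T ^ 2)) := by
      rw [poissonSeries, derivation_kernel _ _ _ hSD, ddE, ddD, dE, dD]
      split_ifs <;> ring
    simp only [hi]
    rw [← Finset.mul_sum]
    simp only [Finset.sum_add_distrib, Finset.sum_sub_distrib, ← Finset.mul_sum, hsum,
      Finset.sum_neg_distrib, Finset.sum_const, Finset.card_univ, Fintype.card_fin,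
      Finset.sum_ite_eq', Finset.mem_univ, if_true, nsmul_eq_mul]
    rw [hDeq]
    ring
  have h4 : (4 : (MvPolynomial (Fin p) ℝ)⟦X⟧) ≠ 0 := by
    have : (4 : (MvPolynomial (Fin p) ℝ)⟦X⟧) = C (MvPolynomial.C 4) := by simp only [map_ofNat]
    intro h0
    rw [this] at h0
    have := congrArg (fun f => MvPolynomial.constantCoeff (constantCoeff f)) h0
    simp at this
  have hD0 : D ≠ 0 := by
    rintro h0
    simp [h0] at hSD
  exact (mul_eq_zero.mp key).resolve_left (mul_ne_zero h4 (pow_ne_zero 2 hD0))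

/-- The coefficients of the formal Poisson kernel are harmonic. -/
lemma polyLaplacian_coeff_poissonSeries (n : ℕ) :
    polyLaplacian p (coeff n (poissonSeries p)) = 0 := by
  have h := congrArg (coeff n) (sum_pderiv_poissonSeries (p := p))
  simpa [polyLaplacian_apply] using h

end Harmonic

/-! ### Zonal polynomials -/

lemma northPole_eq_single (p : ℕ) [NeZero p] : northPole p = Pi.single 0 1 := by
  ext i
  simp [northPole, Pi.single_apply, Fin.val_eq_zero_iff]

lemma dotProduct_northPole {p : ℕ} [NeZero p] (x : Fin p → ℝ) : x ⬝ᵥ northPole p = x 0 := by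
  simp [northPole_eq_single]

lemma eval_normSqPoly {p : ℕ} (x : Fin p → ℝ) :
    MvPolynomial.eval x (normSqPoly p) = x ⬝ᵥ x := by
  simp [normSqPoly, dotProduct, sq]

section Zonal

variable {p : ℕ}

lemma mulVec_dotProduct_mulVec {R : Matrix (Fin p) (Fin p) ℝ}
    (hR : R ∈ Matrix.orthogonalGroup (Fin p) ℝ) (x y : Fin p → ℝ) :
    R.mulVec x ⬝ᵥ R.mulVec y = x ⬝ᵥ y := by
  rw [Matrix.dotProduct_mulVec, Matrix.vecMul_mulVec]
  have h : R.transpose * R = 1 := (Matrix.mem_orthogonalGroup_iff' (Fin p) ℝ).mp hR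
  rw [h, Matrix.vecMul_one]

lemma mulVec_apply_zero [NeZero p] {R : Matrix (Fin p) (Fin p) ℝ}
    (hR : R ∈ Matrix.orthogonalGroup (Fin p) ℝ) (hη : R.mulVec (northPole p) = northPole p)
    (x : Fin p → ℝ) : R.mulVec x 0 = x 0 := by
  rw [← dotProduct_northPole (R.mulVec x), ← dotProduct_northPole x,
    ← mulVec_dotProduct_mulVec hR x, hη]

/-- The homogeneous polynomials of degree `n` that are invariant under the stabiliser of `η` and
whose restriction to the unit sphere is a polynomial in `⟨ξ, η⟩`. -/
noncomputable def zonalSubmodule (p n : ℕ) : Submodule ℝ (MvPolynomial (Fin p) ℝ) where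
  carrier := {L | L.IsHomogeneous n ∧
    (∀ R ∈ Matrix.orthogonalGroup (Fin p) ℝ, R.mulVec (northPole p) = northPole p →
      ∀ x : Fin p → ℝ, MvPolynomial.eval (R.mulVec x) L = MvPolynomial.eval x L) ∧
    ∃ P : Polynomial ℝ, ∀ ξ : Fin p → ℝ, ξ ⬝ᵥ ξ = 1 →
      MvPolynomial.eval ξ L = P.eval (ξ ⬝ᵥ northPole p)}
  add_mem' := by
    rintro a b ⟨ha, ha', P, hP⟩ ⟨hb, hb', Q, hQ⟩
    refine ⟨ha.add hb, fun R hR hη x => ?_, P + Q, fun ξ hξ => ?_⟩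
    · simp [ha' R hR hη x, hb' R hR hη x]
    · simp [hP ξ hξ, hQ ξ hξ]
  zero_mem' := ⟨MvPolynomial.isHomogeneous_zero _ _ _, by simp, 0, by simp⟩
  smul_mem' := by
    rintro c a ⟨ha, ha', P, hP⟩
    refine ⟨(MvPolynomial.homogeneousSubmodule _ _ n).smul_mem c ha, fun R hR hη x => ?_,
      c • P, fun ξ hξ => ?_⟩
    · simp [ha' R hR hη x]
    · simp [hP ξ hξ]

lemma one_mem_zonalSubmodule : 1 ∈ zonalSubmodule p 0 :=
  ⟨MvPolynomial.isHomogeneous_one _ _, by simp, 1, by simp⟩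

lemma mul_mem_zonalSubmodule {a b : MvPolynomial (Fin p) ℝ} {m n : ℕ}
    (ha : a ∈ zonalSubmodule p m) (hb : b ∈ zonalSubmodule p n) :
    a * b ∈ zonalSubmodule p (m + n) := by
  obtain ⟨ha, ha', P, hP⟩ := ha
  obtain ⟨hb, hb', Q, hQ⟩ := hb
  refine ⟨ha.mul hb, fun R hR hη x => ?_, P * Q, fun ξ hξ => ?_⟩
  · simp [ha' R hR hη x, hb' R hR hη x]
  · simp [hP ξ hξ, hQ ξ hξ]

lemma X_zero_mem_zonalSubmodule [NeZero p] : MvPolynomial.X 0 ∈ zonalSubmodule p 1 := by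
  refine ⟨MvPolynomial.isHomogeneous_X _ _, fun R hR hη x => ?_, Polynomial.X, fun ξ _ => ?_⟩
  · simp [mulVec_apply_zero hR hη]
  · simp [dotProduct_northPole]

lemma normSqPoly_mem_zonalSubmodule : normSqPoly p ∈ zonalSubmodule p 2 := by
  refine ⟨MvPolynomial.IsHomogeneous.sum _ _ _ fun i _ => MvPolynomial.isHomogeneous_X_pow _ _,
    fun R hR _ x => ?_, 1, fun ξ hξ => ?_⟩
  · simp [eval_normSqPoly, mulVec_dotProduct_mulVec hR]
  · simp [eval_normSqPoly, hξ]

open PowerSeries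

/-- A power series is zonal if its `n`-th coefficient lies in `zonalSubmodule p n` for all `n`. As
these submodules are multiplicative in `n`, zonal series are closed under products. -/
def IsZonalSeries (f : (MvPolynomial (Fin p) ℝ)⟦X⟧) : Prop :=
  ∀ n, coeff n f ∈ zonalSubmodule p n

lemma IsZonalSeries.mul {f g : (MvPolynomial (Fin p) ℝ)⟦X⟧} (hf : IsZonalSeries f)
    (hg : IsZonalSeries g) : IsZonalSeries (f * g) := fun n => by
  rw [coeff_mul]
  refine Submodule.sum_mem _ fun ij hij => ?_
  rw [← Finset.HasAntidiagonal.mem_antidiagonal.mp hij]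
  exact mul_mem_zonalSubmodule (hf _) (hg _)

lemma isZonalSeries_C_mul_X_pow {a : MvPolynomial (Fin p) ℝ} {m : ℕ}
    (ha : a ∈ zonalSubmodule p m) : IsZonalSeries (C a * X ^ m) := fun n => by
  rw [coeff_C_mul, coeff_X_pow]
  split_ifs with h
  · simpa [h] using ha
  · simp

lemma isZonalSeries_one : IsZonalSeries (1 : (MvPolynomial (Fin p) ℝ)⟦X⟧) := by
  simpa using isZonalSeries_C_mul_X_pow (one_mem_zonalSubmodule (p := p))

lemma IsZonalSeries.sub {f g : (MvPolynomial (Fin p) ℝ)⟦X⟧} (hf : IsZonalSeries f)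
    (hg : IsZonalSeries g) : IsZonalSeries (f - g) := fun n => by
  rw [map_sub]
  exact Submodule.sub_mem _ (hf n) (hg n)

lemma IsZonalSeries.pow {f : (MvPolynomial (Fin p) ℝ)⟦X⟧} (hf : IsZonalSeries f) (k : ℕ) :
    IsZonalSeries (f ^ k) := by
  induction k with
  | zero => simpa using isZonalSeries_one
  | succ k ih => simpa [pow_succ] using ih.mul hf

/-- The coefficients of `invSqrt f` are linear combinations of those of the powers of `f`. -/
lemma IsZonalSeries.invSqrt {f : (MvPolynomial (Fin p) ℝ)⟦X⟧} (hf : IsZonalSeries f)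
    (h0 : constantCoeff f = 0) : IsZonalSeries (invSqrt f) := fun n => by
  rw [PowerSeries.invSqrt, coeff_subst' (HasSubst.of_constantCoeff_zero' h0)]
  refine finsum_induction (· ∈ zonalSubmodule p n) (Submodule.zero_mem _)
    (fun _ _ => Submodule.add_mem _) fun k => ?_
  rw [binomialSeries_coeff, smul_assoc, one_smul]
  exact Submodule.smul_of_tower_mem _ _ (hf.pow k n)

lemma isZonalSeries_kernelBase [NeZero p] : IsZonalSeries (kernelBase p) := by
  refine (isZonalSeries_C_mul_X_pow normSqPoly_mem_zonalSubmodule).sub ?_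
  have h : 2 * MvPolynomial.X 0 ∈ zonalSubmodule p 1 := by
    simpa [two_mul] using
      Submodule.add_mem _ X_zero_mem_zonalSubmodule (X_zero_mem_zonalSubmodule (p := p))
  simpa using isZonalSeries_C_mul_X_pow h

lemma isZonalSeries_poissonSeries [NeZero p] : IsZonalSeries (poissonSeries p) :=
  (isZonalSeries_one.sub (isZonalSeries_C_mul_X_pow normSqPoly_mem_zonalSubmodule)).mul
    ((isZonalSeries_kernelBase.invSqrt constantCoeff_kernelBase).pow p)

end Zonal

/-! ### The dimension of the space of harmonic homogeneous polynomials -/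

section Dim
open MvPolynomial

variable {p : ℕ}

lemma polyLaplacian_isHomogeneous {f : MvPolynomial (Fin p) ℝ} {n : ℕ}
    (hf : f.IsHomogeneous (n + 2)) : (polyLaplacian p f).IsHomogeneous n := by
  rw [polyLaplacian_apply]
  exact IsHomogeneous.sum _ _ _ fun i _ => (hf.pderiv (n := n + 2)).pderiv

lemma finrank_homogeneousSubmodule (p n : ℕ) :
    Module.finrank ℝ (homogeneousSubmodule (Fin p) ℝ n) = (p + n - 1).choose n := by
  classical
  have h : homogeneousSubmodule (Fin p) ℝ n =
      restrictSupport ℝ ((Finset.univ : Finset (Fin p)).finsuppAntidiag n : Set (Fin p →₀ ℕ)) := by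
    rw [homogeneousSubmodule_eq_finsupp_supported]
    congr 1
    ext d
    simp [Finset.mem_finsuppAntidiag, Finsupp.degree_eq_sum]
  rw [h, Module.finrank_eq_nat_card_basis (basisRestrictSupport ℝ _), Nat.card_coe_set_eq,
    Set.ncard_coe_finset, Finset.card_finsuppAntidiag_nat_eq_choose]
  simp

lemma finite_homogeneousSubmodule (p n : ℕ) :
    Module.Finite ℝ (homogeneousSubmodule (Fin p) ℝ n) :=
  Module.Finite.iff_fg.mpr (homogeneousSubmodule_fg _ _ n)

/-- Every monomial `m` of degree `n` is the Laplacian of a homogeneous polynomial of degree `n + 2`.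
The induction is on the degree `k` of `m` in the variables other than `x₀`: up to a nonzero factor,
`Δ (x₀² m)` is `m` plus monomials whose degree in these variables is smaller. -/
lemma monomial_mem_map_polyLaplacian [NeZero p] (n : ℕ) (k : ℕ) (d : Fin p →₀ ℕ)
    (hd : d.degree = n) (hk : d.degree = d 0 + k) :
    monomial d (1 : ℝ) ∈ (homogeneousSubmodule (Fin p) ℝ (n + 2)).map (polyLaplacian p) := by
  induction k using Nat.strong_induction_on generalizing d with
  | _ k ih =>
  set M := (homogeneousSubmodule (Fin p) ℝ (n + 2)).map (polyLaplacian p)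
  have hdeg : (d + Finsupp.single 0 2).degree = n + 2 := by simp [hd]
  have hmem : polyLaplacian p (monomial (d + Finsupp.single 0 2) (1 : ℝ)) ∈ M :=
    Submodule.mem_map_of_mem (isHomogeneous_monomial _ hdeg)
  have hrest : ∀ i ≠ 0, pderiv i (pderiv i (monomial (d + Finsupp.single 0 2) (1 : ℝ))) ∈ M := by
    intro i hi
    rw [pderiv_monomial, pderiv_monomial]
    by_cases h2 : d i < 2
    · -- the coefficient `(d i) (d i - 1)` vanishes
      have : d i = 0 ∨ d i = 1 := by omega
      rcases this with h | h <;> simp [h, hi]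
    · set e := d + Finsupp.single 0 2 - Finsupp.single i 1 - Finsupp.single i 1 with he
      have he' : e + Finsupp.single i 2 = d + Finsupp.single 0 2 := by
        ext j
        by_cases hj : i = j
        · subst hj
          simp [he, hi]
          omega
        · simp [he, hj]
      have hed : e.degree = n := by
        have := congrArg Finsupp.degree he'
        simp [hd] at this
        exact this
      have he0 : e 0 = d 0 + 2 := by simp [he, hi]
      have hle := Finsupp.le_degree 0 e
      rw [← mul_one (1 * _ * _), ← smul_eq_mul, ← smul_monomial]
      exact Submodule.smul_mem M _ (ih (k - 2) (by omega) e hed (by rw [he0] at hle ⊢; omega))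
  rw [polyLaplacian_apply, ← Finset.add_sum_erase _ _ (Finset.mem_univ 0)] at hmem
  have h0 := (Submodule.add_mem_iff_left M
    (Submodule.sum_mem M fun i hi => hrest i (Finset.ne_of_mem_erase hi))).mp hmem
  have h1 : pderiv 0 (pderiv 0 (monomial (d + Finsupp.single 0 2) (1 : ℝ))) =
      ((d 0 + 2 : ℝ) * (d 0 + 1)) • monomial d (1 : ℝ) := by
    rw [pderiv_monomial, pderiv_monomial, smul_monomial]
    have hd2 : d + Finsupp.single 0 2 - Finsupp.single 0 1 - Finsupp.single 0 1 = d := by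
      ext j
      by_cases hj : (0 : Fin p) = j
      · subst hj
        simp
      · simp [hj]
    rw [hd2]
    congr 1
    simp
  rw [h1] at h0
  exact (Submodule.smul_mem_iff M (by positivity)).mp h0

lemma map_polyLaplacian_homogeneousSubmodule [NeZero p] (n : ℕ) :
    (homogeneousSubmodule (Fin p) ℝ (n + 2)).map (polyLaplacian p) =
      homogeneousSubmodule (Fin p) ℝ n := by
  apply le_antisymm
  · rintro _ ⟨f, hf, rfl⟩
    exact polyLaplacian_isHomogeneous hf
  · intro f hf
    rw [f.as_sum]
    refine Submodule.sum_mem _ fun d hd => ?_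
    rw [← mul_one (coeff d f), ← smul_eq_mul, ← smul_monomial]
    have hdeg : d.degree = n := by
      by_contra hne
      exact mem_support_iff.mp hd (IsHomogeneous.coeff_eq_zero hf hne)
    refine Submodule.smul_mem _ _
      (monomial_mem_map_polyLaplacian n (d.degree - d 0) d hdeg ?_)
    have := Finsupp.le_degree 0 d
    omega

lemma harmonicDim_add_two [NeZero p] (n : ℕ) :
    harmonicDim p (n + 2) + (p + n - 1).choose n = (p + (n + 2) - 1).choose (n + 2) := by
  have := finite_homogeneousSubmodule p (n + 2)
  rw [← finrank_homogeneousSubmodule p n, ← finrank_homogeneousSubmodule p (n + 2),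
    ← map_polyLaplacian_homogeneousSubmodule, add_comm, harmonicDim, harmonicHomogeneous,
    ← LinearMap.range_domRestrict, ← LinearMap.finrank_range_add_finrank_ker
      ((polyLaplacian p).domRestrict (homogeneousSubmodule (Fin p) ℝ (n + 2)))]
  congr 1
  rw [LinearMap.ker_domRestrict, ← Submodule.map_comap_subtype, Submodule.finrank_map_subtype_eq]

lemma harmonicDim_of_lt_two {n : ℕ} (hn : n < 2) :
    harmonicDim p n = (p + n - 1).choose n := by
  rw [← finrank_homogeneousSubmodule p n, harmonicDim, harmonicHomogeneous, inf_eq_left.mpr]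
  intro f hf
  rw [LinearMap.mem_ker, polyLaplacian_apply]
  refine Finset.sum_eq_zero fun i _ => ?_
  have h := (IsHomogeneous.pderiv (i := i) hf)
  rw [show n - 1 = 0 by omega, ← totalDegree_zero_iff_isHomogeneous,
    totalDegree_eq_zero_iff_eq_C] at h
  rw [h, pderiv_C]

end Dim

/-! ### Absolute convergence of the generating function -/

section Convergence
open PowerSeries

/-- The power series `f` converges absolutely at `z`, with sum `v`. -/
def HasAbsSum (f : ℂ⟦X⟧) (z v : ℂ) : Prop :=
  Summable (fun n => ‖coeff n f * z ^ n‖) ∧ HasSum (fun n => coeff n f * z ^ n) v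

lemma HasAbsSum.of_summable {f : ℂ⟦X⟧} {z : ℂ} (h : Summable (fun n => ‖coeff n f * z ^ n‖)) :
    ∃ v, HasAbsSum f z v :=
  ⟨_, h, h.of_norm.hasSum⟩

lemma HasAbsSum.unique {f : ℂ⟦X⟧} {z v w : ℂ} (h : HasAbsSum f z v) (h' : HasAbsSum f z w) :
    v = w := h.2.unique h'.2

lemma HasAbsSum.mul {f g : ℂ⟦X⟧} {z v w : ℂ} (hf : HasAbsSum f z v) (hg : HasAbsSum g z w) :
    HasAbsSum (f * g) z (v * w) := by
  have h : ∀ n, coeff n (f * g) * z ^ n =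
      ∑ kl ∈ Finset.HasAntidiagonal.antidiagonal n,
        (coeff kl.1 f * z ^ kl.1) * (coeff kl.2 g * z ^ kl.2) := by
    intro n
    rw [coeff_mul, Finset.sum_mul]
    refine Finset.sum_congr rfl fun kl hkl => ?_
    rw [← Finset.HasAntidiagonal.mem_antidiagonal.mp hkl, pow_add]
    ring
  have hs := summable_norm_sum_mul_antidiagonal_of_summable_norm hf.1 hg.1
  refine ⟨by simpa only [h] using hs, ?_⟩
  simp only [h]
  rw [← hf.2.tsum_eq, ← hg.2.tsum_eq,
    tsum_mul_tsum_eq_tsum_sum_antidiagonal_of_summable_norm hf.1 hg.1]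
  exact hs.of_norm.hasSum

lemma hasAbsSum_coe (q : Polynomial ℂ) (z : ℂ) : HasAbsSum (q : ℂ⟦X⟧) z (q.eval z) := by
  have h0 : ∀ n ∉ q.support, coeff n (q : ℂ⟦X⟧) * z ^ n = 0 := by
    intro n hn
    rw [Polynomial.coeff_coe, Polynomial.notMem_support_iff.mp hn, zero_mul]
  refine ⟨summable_of_ne_finset_zero (s := q.support) fun n hn => by rw [h0 n hn, norm_zero], ?_⟩
  rw [Polynomial.eval_eq_sum, Polynomial.sum]
  simpa using hasSum_sum_of_ne_finset_zero h0

lemma HasAbsSum.pow {f : ℂ⟦X⟧} {z v : ℂ} (hf : HasAbsSum f z v) (k : ℕ) :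
    HasAbsSum (f ^ k) z (v ^ k) := by
  induction k with
  | zero => simpa using hasAbsSum_coe 1 z
  | succ k ih => simpa only [pow_succ] using ih.mul hf

lemma abs_choose_neg_half_le (n : ℕ) : |(Ring.choose (-1 / 2 : ℚ) n)| ≤ 1 := by
  have h : |(descPochhammer ℤ n).smeval (-1 / 2 : ℚ)| ≤ n.factorial := by
    induction n with
    | zero => simp
    | succ n ih =>
      rw [descPochhammer_succ_right, Polynomial.smeval_mul, abs_mul, Nat.factorial_succ, mul_comm]
      push_cast
      refine mul_le_mul ?_ ih (abs_nonneg _) (by positivity)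
      simp [Polynomial.smeval_sub, Polynomial.smeval_natCast]
      rw [abs_le]
      constructor <;> linarith
  rw [Ring.choose_eq_smul, smul_eq_mul, abs_mul, abs_inv, Nat.abs_cast]
  exact (inv_mul_le_one₀ (by positivity)).mpr h

/-- For `‖w‖ = 1` the series `(1 + w T)^(-1/2)` converges in the open unit disc, since its
coefficients are bounded by one. -/
lemma exists_hasAbsSum_rescale_binomialSeries {w r : ℂ} (hw : ‖w‖ = 1) (hr : ‖r‖ < 1) :
    ∃ v, HasAbsSum (rescale w (PowerSeries.binomialSeries ℂ (-1 / 2 : ℚ))) r v := by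
  refine HasAbsSum.of_summable
    (Summable.of_nonneg_of_le (fun n => norm_nonneg _) (fun n => ?_)
      (summable_geometric_of_lt_one (norm_nonneg r) hr))
  rw [coeff_rescale, PowerSeries.binomialSeries_coeff, norm_mul, norm_mul, norm_pow, norm_pow,
    hw, one_pow, one_mul]
  refine mul_le_of_le_one_left (by positivity) ?_
  have h := abs_choose_neg_half_le n
  rw [Rat.smul_def, mul_one, Complex.norm_ratCast]
  exact_mod_cast h

lemma rescale_binomialSeries_neg_half_sq (w : ℂ) :
    rescale w (PowerSeries.binomialSeries ℂ (-1 / 2 : ℚ)) ^ 2 * (1 + C w * X) = 1 := by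
  have h := congrArg (rescale w) (binomialSeries_neg_half_sq (A := ℂ))
  simpa using h

/-- Over a field of characteristic zero, a power series `f` with `f² D = 1` is determined by the
normalisation that its constant term is one. -/
lemma PowerSeries.eq_of_sq_mul_eq_one {K : Type*} [Field K] [CharZero K] {f g D : K⟦X⟧}
    (hf : f ^ 2 * D = 1) (hg : g ^ 2 * D = 1) (hf1 : constantCoeff f = 1)
    (hg1 : constantCoeff g = 1) : f = g := by
  have hD : D ≠ 0 := by
    rintro rfl
    simp at hf
  have h : f ^ 2 = g ^ 2 := mul_right_cancel₀ hD (hf.trans hg.symm)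
  rcases sq_eq_sq_iff_eq_or_eq_neg.mp h with h | h
  · exact h
  · rw [h, map_neg, hg1] at hf1
    norm_num at hf1

/-- The formal power series `(1 - 2 t T + T²)^(-1/2)` converges in the open unit disc when
`-1 ≤ t ≤ 1`: it is the product of `(1 + w T)^(-1/2)` and `(1 + w̄ T)^(-1/2)` for a complex number
`w` of modulus one with real part `-t`. On the real line the two factors are conjugate, so the sum
is the positive square root. -/
lemma hasAbsSum_of_sq_mul_eq_one {r t : ℝ} (hr : |r| < 1) (ht : t ∈ Set.Icc (-1 : ℝ) 1) {s : ℂ⟦X⟧}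
    (hs : s ^ 2 * (1 - C (2 * (t : ℂ)) * X + X ^ 2) = 1) (hs1 : constantCoeff s = 1) :
    HasAbsSum s r ((√(1 - 2 * r * t + r ^ 2))⁻¹ : ℝ) := by
  set b := PowerSeries.binomialSeries ℂ (-1 / 2 : ℚ) with hb
  set w : ℂ := ⟨-t, √(1 - t ^ 2)⟩ with hw
  have hsq : √(1 - t ^ 2) ^ 2 = 1 - t ^ 2 := Real.sq_sqrt (by nlinarith [ht.1, ht.2])
  have hww : w * (starRingEnd ℂ) w = 1 := by
    rw [Complex.mul_conj, Complex.normSq_mk]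
    norm_cast
    linarith
  have hwadd : w + (starRingEnd ℂ) w = - (2 * t) := by
    rw [Complex.add_conj]
    simp [hw]
  have hwn : ‖w‖ = 1 := by
    have := Complex.mul_conj w
    rw [hww, Complex.normSq_eq_norm_sq] at this
    have h2 : ‖w‖ ^ 2 = 1 := by exact_mod_cast this.symm
    exact (pow_eq_one_iff_of_nonneg (norm_nonneg w) two_ne_zero).mp h2
  obtain ⟨v, hv⟩ := exists_hasAbsSum_rescale_binomialSeries hwn (r := r) (by simpa using hr)
  have hcoeff : ∀ n, coeff n (rescale ((starRingEnd ℂ) w) b) * (r : ℂ) ^ n =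
      (starRingEnd ℂ) (coeff n (rescale w b) * (r : ℂ) ^ n) := by
    intro n
    simp [coeff_rescale, hb, Rat.smul_def]
  have hv' : HasAbsSum (rescale ((starRingEnd ℂ) w) b) r ((starRingEnd ℂ) v) := by
    refine ⟨by simpa only [hcoeff, RCLike.norm_conj] using hv.1, ?_⟩
    simp only [hcoeff]
    exact Complex.hasSum_conj'.mpr hv.2
  have hfac : s = rescale w b * rescale ((starRingEnd ℂ) w) b := by
    refine PowerSeries.eq_of_sq_mul_eq_one hs ?_ hs1 ?_
    · have h1 := rescale_binomialSeries_neg_half_sq w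
      have h2 := rescale_binomialSeries_neg_half_sq ((starRingEnd ℂ) w)
      have h3 : (1 - C (2 * (t : ℂ)) * X + X ^ 2 : ℂ⟦X⟧) =
          (1 + C w * X) * (1 + C ((starRingEnd ℂ) w) * X) := by
        have e1 : (C w * C ((starRingEnd ℂ) w) : ℂ⟦X⟧) = 1 := by rw [← map_mul, hww, map_one]
        have e2 : (C w + C ((starRingEnd ℂ) w) : ℂ⟦X⟧) = - C (2 * (t : ℂ)) := by
          rw [← map_add, hwadd, map_neg]
        linear_combination -X * e2 - X ^ 2 * e1
      rw [h3, mul_pow]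
      calc _ = (rescale w b ^ 2 * (1 + C w * X)) *
          (rescale ((starRingEnd ℂ) w) b ^ 2 * (1 + C ((starRingEnd ℂ) w) * X)) := by ring
        _ = 1 := by rw [h1, h2, one_mul]
    · have hc (a : ℂ) : constantCoeff (rescale a b) = 1 := by
        rw [← coeff_zero_eq_constantCoeff_apply, coeff_rescale]
        simp [hb]
      rw [map_mul, hc, hc, one_mul]
  have hprod := hv.mul hv'
  rw [← hfac, Complex.mul_conj] at hprod
  convert hprod using 2
  have hpoly : HasAbsSum (1 - C (2 * (t : ℂ)) * X + X ^ 2) r (1 - 2 * t * r + r ^ 2) := by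
    have := hasAbsSum_coe (1 - Polynomial.C (2 * (t : ℂ)) * Polynomial.X + Polynomial.X ^ 2) r
    simpa using this
  have hone := (hprod.pow 2).mul hpoly
  rw [hs] at hone
  replace hone := hone.unique (by simpa using hasAbsSum_coe 1 r)
  have hone' : Complex.normSq v ^ 2 * (1 - 2 * r * t + r ^ 2) = 1 := by
    have : (Complex.normSq v : ℂ) ^ 2 * (1 - 2 * r * t + r ^ 2) = 1 := by
      linear_combination hone
    exact_mod_cast this
  -- `normSq v` is nonnegative, which selects the positive root of `x² (1 - 2 r t + r²) = 1`
  rw [inv_eq_iff_eq_inv, ← Real.sqrt_sq (inv_nonneg.mpr (Complex.normSq_nonneg v))]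
  congr 1
  rw [inv_pow]
  exact eq_inv_of_mul_eq_one_right hone'

end Convergence

/-! ### Uniqueness of the zonal harmonic -/

section Uniqueness

open Polynomial

/-- The polynomial `∑_{i ≠ 0} xᵢ²`. -/
noncomputable def tailSqPoly (p : ℕ) [NeZero p] : MvPolynomial (Fin p) ℝ :=
  normSqPoly p - MvPolynomial.X 0 ^ 2

/-- The polynomial `g(x₀, ∑_{i ≠ 0} xᵢ²)` attached to a bivariate polynomial `g`, whose outer
variable stands for `∑_{i ≠ 0} xᵢ²`. -/
noncomputable def zonalEval (p : ℕ) [NeZero p] : ℝ[X][X] →+* MvPolynomial (Fin p) ℝ :=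
  eval₂RingHom (aeval (MvPolynomial.X 0) : ℝ[X] →ₐ[ℝ] MvPolynomial (Fin p) ℝ).toRingHom
    (tailSqPoly p)

/-- The second derivative in the inner variable of a bivariate polynomial. -/
noncomputable def innerDeriv2 (g : ℝ[X][X]) : ℝ[X][X] :=
  g.sum fun k q => monomial k (derivative (derivative q))

lemma coeff_innerDeriv2 (g : ℝ[X][X]) (k : ℕ) :
    (innerDeriv2 g).coeff k = derivative (derivative (g.coeff k)) := by
  simp only [innerDeriv2, Polynomial.sum_def, finsetSum_coeff, coeff_monomial]
  rw [Finset.sum_ite_eq']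
  split_ifs with h
  · rfl
  · simp [notMem_support_iff.mp h]

variable {p : ℕ} [NeZero p]

lemma zonalEval_monomial (k : ℕ) (q : ℝ[X]) :
    zonalEval p (monomial k q) = aeval (MvPolynomial.X 0) q * tailSqPoly p ^ k := by
  simp [zonalEval, eval₂_monomial]

lemma zonalEval_X : zonalEval p X = tailSqPoly p := by
  simp [zonalEval]

lemma pderiv_tailSqPoly (i : Fin p) :
    MvPolynomial.pderiv i (tailSqPoly p) = if i = 0 then 0 else 2 * MvPolynomial.X i := by
  rw [tailSqPoly, map_sub, pderiv_normSqPoly, Derivation.leibniz_pow, pderiv_X_zero]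
  split_ifs with h
  · subst h
    simp
  · simp

lemma polyLaplacian_zonalEval_monomial (k : ℕ) (q : ℝ[X]) :
    polyLaplacian p (zonalEval p (monomial k q)) =
      zonalEval p (monomial k (derivative (derivative q))
        + 2 * ((p : ℝ[X][X]) - 1) * derivative (monomial k q)
        + 4 * X * derivative (derivative (monomial k q))) := by
  set a : ℝ[X] → MvPolynomial (Fin p) ℝ := fun q => aeval (MvPolynomial.X 0) q with ha
  set s := tailSqPoly p with hs
  have hR : zonalEval p (monomial k (derivative (derivative q))
        + 2 * ((p : ℝ[X][X]) - 1) * derivative (monomial k q)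
        + 4 * X * derivative (derivative (monomial k q))) =
      a (derivative (derivative q)) * s ^ k
        + 2 * ((p : MvPolynomial (Fin p) ℝ) - 1) * (a q * (k * s ^ (k - 1)))
        + 4 * s * (a q * (k * (((k - 1 : ℕ) : MvPolynomial (Fin p) ℝ) * s ^ (k - 1 - 1)))) := by
    simp only [derivative_monomial, map_add, map_mul, zonalEval_monomial, zonalEval_X, map_sub,
      map_ofNat, map_one, map_natCast, ha, hs]
    ring
  have hi (i : Fin p) : MvPolynomial.pderiv i (MvPolynomial.pderiv i (a q * s ^ k)) =
      (if i = 0 then a (derivative (derivative q)) * s ^ k else 0) +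
      ((1 - if i = 0 then 1 else 0) * (2 * (a q * ((k : MvPolynomial (Fin p) ℝ) * s ^ (k - 1)))) +
        (MvPolynomial.X i ^ 2 - if i = 0 then MvPolynomial.X i ^ 2 else 0) *
          (4 * (a q * ((k : MvPolynomial (Fin p) ℝ) *
            (((k - 1 : ℕ) : MvPolynomial (Fin p) ℝ) * s ^ (k - 1 - 1)))))) := by
    by_cases h : i = 0
    · simp [h, ha, hs, Derivation.leibniz, Derivation.leibniz_pow, pderiv_tailSqPoly]
      ring
    · have h2 : MvPolynomial.pderiv i (2 : MvPolynomial (Fin p) ℝ) = 0 := by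
        exact_mod_cast (MvPolynomial.pderiv i).map_natCast 2
      simp [h, ha, hs, Derivation.leibniz, Derivation.leibniz_pow, pderiv_tailSqPoly, h2]
      ring
  rw [hR, zonalEval_monomial, polyLaplacian_apply]
  change ∑ i, MvPolynomial.pderiv i (MvPolynomial.pderiv i (a q * s ^ k)) = _
  simp only [hi, Finset.sum_add_distrib, ← Finset.sum_mul, Finset.sum_sub_distrib,
    Finset.sum_ite_eq', Finset.mem_univ, if_true]
  have : ∑ i : Fin p, (MvPolynomial.X i ^ 2 : MvPolynomial (Fin p) ℝ) - MvPolynomial.X 0 ^ 2 = s :=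
    rfl
  rw [this]
  simp
  ring

/-- The Laplacian in the coordinates `a = x₀`, `s = ∑_{i ≠ 0} xᵢ²` is
`∂ₐ² + 2 (p - 1) ∂ₛ + 4 s ∂ₛ²`. -/
lemma polyLaplacian_zonalEval (g : ℝ[X][X]) :
    polyLaplacian p (zonalEval p g) = zonalEval p (innerDeriv2 g
        + 2 * ((p : ℝ[X][X]) - 1) * derivative g + 4 * X * derivative (derivative g)) := by
  conv_lhs => rw [g.as_sum_support]
  have h : innerDeriv2 g + 2 * ((p : ℝ[X][X]) - 1) * derivative g
      + 4 * X * derivative (derivative g) =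
      ∑ k ∈ g.support, (monomial k (derivative (derivative (g.coeff k)))
        + 2 * ((p : ℝ[X][X]) - 1) * derivative (monomial k (g.coeff k))
        + 4 * X * derivative (derivative (monomial k (g.coeff k)))) := by
    rw [Finset.sum_add_distrib, Finset.sum_add_distrib, ← Finset.mul_sum, ← Finset.mul_sum]
    simp only [← map_sum, ← g.as_sum_support]
    rfl
  rw [h, map_sum, map_sum, map_sum]
  exact Finset.sum_congr rfl fun k _ => polyLaplacian_zonalEval_monomial k _

/-- The point with coordinates `a` at `0`, `s` at `j` and zero elsewhere. -/
def planePoint (j : Fin p) (a s : ℝ) : Fin p → ℝ := fun i =>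
  if i = 0 then a else if i = j then s else 0

lemma planePoint_dotProduct_self {j : Fin p} (hj : j ≠ 0) (a s : ℝ) :
    planePoint j a s ⬝ᵥ planePoint j a s = a ^ 2 + s ^ 2 := by
  have h (i : Fin p) : planePoint j a s i * planePoint j a s i =
      (if i = 0 then a ^ 2 else 0) + if i = j then s ^ 2 else 0 := by
    unfold planePoint
    by_cases h0 : i = 0
    · subst h0
      simp [hj.symm, sq]
    · by_cases h1 : i = j <;> simp [h0, h1, hj, sq]
  simp [dotProduct, h, Finset.sum_add_distrib]

lemma eval_zonalEval (g : ℝ[X][X]) (x : Fin p → ℝ) :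
    MvPolynomial.eval x (zonalEval p g) = (g.eval (C (x ⬝ᵥ x - x 0 ^ 2))).eval (x 0) := by
  induction g using Polynomial.induction_on' with
  | add f g hf hg => simp [hf, hg]
  | monomial k q =>
    rw [zonalEval_monomial, map_mul, map_pow, tailSqPoly, map_sub, eval_normSqPoly,
      eval_monomial, eval_mul, eval_pow, eval_C, map_pow, MvPolynomial.eval_X]
    congr 1
    induction q using Polynomial.induction_on' with
    | add f g hf hg => simp [hf, hg]
    | monomial n c => simp

/-- A bivariate polynomial that vanishes at all `(a, s)` with `s` a square is zero. -/
lemma eq_zero_of_eval_sq_eq_zero {g : ℝ[X][X]}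
    (h : ∀ a s : ℝ, (g.eval (C (s ^ 2))).eval a = 0) : g = 0 := by
  refine Polynomial.eq_zero_of_infinite_isRoot g (Set.Infinite.mono
    (s := Set.range fun n : ℕ => (C ((n : ℝ) ^ 2) : ℝ[X])) ?_ (Set.infinite_range_of_injective ?_))
  · rintro _ ⟨n, rfl⟩
    exact Polynomial.funext fun a => by simpa using h a n
  · intro m n hmn
    have h1 := C_injective hmn
    have h2 := (pow_left_inj₀ (Nat.cast_nonneg m) (Nat.cast_nonneg n) two_ne_zero).mp h1
    exact_mod_cast h2

lemma zonalEval_injective (hp : 2 ≤ p) : Function.Injective (zonalEval p) := by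
  rw [injective_iff_map_eq_zero]
  intro g hg
  have hj : (⟨1, hp⟩ : Fin p) ≠ 0 := by simp [Fin.ext_iff]
  refine eq_zero_of_eval_sq_eq_zero fun a s => ?_
  have h := eval_zonalEval g (planePoint ⟨1, hp⟩ a s)
  rw [hg, planePoint_dotProduct_self hj] at h
  simpa [planePoint] using h.symm

/-- The stabiliser of `η` in the orthogonal group acts transitively on the points of given norm and
given `0`-th coordinate: the reflection exchanging two such points fixes `η`. -/
lemma exists_orthogonal_mulVec_eq {x y : Fin p → ℝ} (h0 : x 0 = y 0) (hxy : x ⬝ᵥ x = y ⬝ᵥ y) :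
    ∃ R ∈ Matrix.orthogonalGroup (Fin p) ℝ,
      R.mulVec (northPole p) = northPole p ∧ R.mulVec x = y := by
  by_cases hne : x = y
  · exact ⟨1, one_mem _, by simp, by simp [hne]⟩
  set v := x - y with hv
  have hv0 : v ⬝ᵥ v ≠ 0 := by
    rw [Ne, dotProduct_self_eq_zero]
    exact sub_ne_zero.mpr hne
  have hR (z : Fin p → ℝ) : (1 - (2 / (v ⬝ᵥ v)) • Matrix.vecMulVec v v).mulVec z =
      z - (2 * (v ⬝ᵥ z) / (v ⬝ᵥ v)) • v := by
    rw [Matrix.sub_mulVec, Matrix.one_mulVec, Matrix.smul_mulVec, Matrix.vecMulVec_mulVec]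
    ext i
    simp
    ring
  refine ⟨1 - (2 / (v ⬝ᵥ v)) • Matrix.vecMulVec v v, ?_, ?_, ?_⟩
  · have hc : (2 / (v ⬝ᵥ v)) * (2 / (v ⬝ᵥ v)) * (v ⬝ᵥ v) = 2 * (2 / (v ⬝ᵥ v)) := by
      field_simp
    rw [Matrix.mem_orthogonalGroup_iff]
    rw [Matrix.transpose_sub, Matrix.transpose_one, Matrix.transpose_smul,
      Matrix.transpose_vecMulVec, sub_mul, mul_sub, mul_sub, one_mul, mul_one, one_mul,
      smul_mul_smul_comm, Matrix.vecMulVec_mul_vecMulVec]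
    ext i j
    simp [Matrix.vecMulVec_apply]
    linear_combination v i * v j * hc
  · rw [hR, dotProduct_northPole]
    simp [hv, h0]
  · rw [hR]
    have : 2 * (v ⬝ᵥ x) = v ⬝ᵥ v := by
      simp only [hv, sub_dotProduct, dotProduct_sub, hxy, dotProduct_comm y x]
      ring
    rw [this, div_self hv0, one_smul, hv, sub_sub_cancel]

lemma eval_eval_aeval_planePoint (j : Fin p) (a s : ℝ) (L : MvPolynomial (Fin p) ℝ) :
    ((MvPolynomial.aeval (fun i : Fin p => if i = 0 then (C X : ℝ[X][X]) else
      if i = j then X else 0) L).eval (C s)).eval a = MvPolynomial.eval (planePoint j a s) L := by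
  induction L using MvPolynomial.induction_on with
  | C c => simp [Polynomial.algebraMap_apply]
  | add f g hf hg => simp [hf, hg]
  | mul_X f i hf =>
    rw [map_mul, eval_mul, eval_mul, hf, map_mul, MvPolynomial.aeval_X, MvPolynomial.eval_X]
    congr 1
    unfold planePoint
    split_ifs <;> simp

lemma eval_smul_of_isHomogeneous {σ : Type*} {L : MvPolynomial σ ℝ} {n : ℕ}
    (hL : L.IsHomogeneous n) (a : ℝ) (x : σ → ℝ) :
    MvPolynomial.eval (a • x) L = a ^ n * MvPolynomial.eval x L := by
  rw [MvPolynomial.eval_eq, MvPolynomial.eval_eq, Finset.mul_sum]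
  refine Finset.sum_congr rfl fun d hd => ?_
  rw [hL.degree_eq_sum_deg_support hd, ← Finset.prod_pow_eq_pow_sum]
  simp only [Pi.smul_apply, smul_eq_mul, mul_pow, Finset.prod_mul_distrib]
  ring

/-- A polynomial invariant under the stabiliser of `η` is a polynomial in `x₀` and
`∑_{i ≠ 0} xᵢ²`. -/
lemma exists_eq_zonalEval (hp : 2 ≤ p) {L : MvPolynomial (Fin p) ℝ}
    (hL : ∀ R ∈ Matrix.orthogonalGroup (Fin p) ℝ, R.mulVec (northPole p) = northPole p →
      ∀ x : Fin p → ℝ, MvPolynomial.eval (R.mulVec x) L = MvPolynomial.eval x L) :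
    ∃ g, L = zonalEval p g := by
  set j : Fin p := ⟨1, hp⟩
  have hj : j ≠ 0 := by simp [j, Fin.ext_iff]
  have hinv (x y : Fin p → ℝ) (h0 : x 0 = y 0) (hxy : x ⬝ᵥ x = y ⬝ᵥ y) :
      MvPolynomial.eval x L = MvPolynomial.eval y L := by
    obtain ⟨R, hR, hη, rfl⟩ := exists_orthogonal_mulVec_eq h0 hxy
    exact (hL R hR hη x).symm
  -- the restriction of `L` to the plane spanned by the coordinates `0` and `j`
  set f : ℝ[X][X] := MvPolynomial.aeval (fun i : Fin p => if i = 0 then C X else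
    if i = j then X else 0) L with hf
  have hfe (a s : ℝ) : (f.eval (C s)).eval a = MvPolynomial.eval (planePoint j a s) L := by
    rw [hf]
    exact eval_eval_aeval_planePoint j a s L
  -- the points `(a, s)` and `(a, -s)` have the same value, so only even powers of `s` occur
  have heven : f.comp (C (-1) * X) = f := by
    rw [← sub_eq_zero]
    refine eq_zero_of_eval_sq_eq_zero fun a s => ?_
    have h : (C (-1) * X : ℝ[X][X]).eval (C (s ^ 2)) = C (-s ^ 2) := by simp
    rw [eval_sub, eval_sub, eval_comp, h, hfe, hfe, sub_eq_zero]
    refine hinv _ _ (by simp [planePoint]) ?_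
    rw [planePoint_dotProduct_self hj, planePoint_dotProduct_self hj, neg_sq]
  have hodd (n : ℕ) (hn : ¬ 2 ∣ n) : f.coeff n = 0 := by
    have h := congrArg (fun q => coeff q n) heven
    have hn' : Odd n := by rwa [← Nat.not_even_iff_odd, even_iff_two_dvd]
    simp only [comp_C_mul_X_coeff, hn'.neg_one_pow] at h
    have h2 : (2 : ℝ[X]) * f.coeff n = 0 := by linear_combination -h
    exact (mul_eq_zero.mp h2).resolve_left two_ne_zero
  refine ⟨contract 2 f, MvPolynomial.funext fun x => ?_⟩
  have hexp : f = expand ℝ[X] 2 (contract 2 f) := by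
    ext1 n
    rw [coeff_expand two_pos, coeff_contract two_ne_zero]
    split_ifs with h
    · rw [Nat.div_mul_cancel h]
    · exact hodd n h
  have hx : 0 ≤ x ⬝ᵥ x - x 0 ^ 2 := by
    rw [dotProduct, ← Finset.add_sum_erase _ _ (Finset.mem_univ 0)]
    have := Finset.sum_nonneg (s := Finset.univ.erase (0 : Fin p))
      (f := fun i => x i * x i) fun i _ => mul_self_nonneg (x i)
    linarith
  rw [hinv x (planePoint j (x 0) √(x ⬝ᵥ x - x 0 ^ 2)) (by simp [planePoint])
    (by rw [planePoint_dotProduct_self hj, Real.sq_sqrt hx]; ring), ← hfe, hexp, expand_eval,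
    eval_zonalEval, ← map_pow, Real.sq_sqrt hx, ← hexp]

/-- An invariant harmonic homogeneous polynomial vanishing at `η` is zero: it is a sum
`∑ₖ gₖ(x₀) sᵏ` with `s = ∑_{i ≠ 0} xᵢ²`, harmonicity expresses `gₖ₊₁` through `gₖ''`, and `g₀`
vanishes by homogeneity. -/
lemma eq_zero_of_eval_northPole_eq_zero (hp : 2 ≤ p) {n : ℕ} {L : MvPolynomial (Fin p) ℝ}
    (hmem : L ∈ harmonicHomogeneous p n) (hη : MvPolynomial.eval (northPole p) L = 0)
    (hL : ∀ R ∈ Matrix.orthogonalGroup (Fin p) ℝ, R.mulVec (northPole p) = northPole p →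
      ∀ x : Fin p → ℝ, MvPolynomial.eval (R.mulVec x) L = MvPolynomial.eval x L) : L = 0 := by
  obtain ⟨g, rfl⟩ := exists_eq_zonalEval hp hL
  have hlap : polyLaplacian p (zonalEval p g) = 0 := hmem.2
  rw [polyLaplacian_zonalEval, map_eq_zero_iff _ (zonalEval_injective hp)] at hlap
  have hrec (k : ℕ) : derivative (derivative (g.coeff k)) +
      (2 * (k + 1) * (2 * k + (p - 1) : ℝ[X])) * g.coeff (k + 1) = 0 := by
    have h := congrArg (fun q => coeff q k) hlap
    have e1 : 2 * ((p : ℝ[X][X]) - 1) * derivative g = C (2 * ((p : ℝ[X]) - 1)) * derivative g := by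
      simp only [map_mul, map_ofNat, map_sub, map_natCast, map_one]
    have e2 : (X * derivative (derivative g)).coeff k = g.coeff (k + 1) * (k + 1) * k := by
      rcases k with _ | k
      · simp
      · simp only [coeff_X_mul, coeff_derivative]
        push_cast
        ring
    have e3 : 4 * X * derivative (derivative g) = C 4 * (X * derivative (derivative g)) := by
      rw [map_ofNat, mul_assoc]
    simp only [coeff_add, coeff_innerDeriv2, coeff_zero, e1, e3, coeff_C_mul, e2,
      coeff_derivative] at h
    linear_combination h
  have h0 : g.coeff 0 = 0 := by
    refine Polynomial.funext fun a => ?_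
    have h := eval_zonalEval g (a • northPole p)
    rw [eval_smul_of_isHomogeneous hmem.1, hη, mul_zero] at h
    have hx : (a • northPole p) 0 = a := by simp [northPole_eq_single]
    have hs : (a • northPole p) ⬝ᵥ (a • northPole p) - a ^ 2 = 0 := by
      simp [northPole_eq_single, sq]
    rw [hx, hs, map_zero] at h
    rw [coeff_zero_eq_eval_zero, ← h, eval_zero]
  have hk (k : ℕ) : g.coeff k = 0 := by
    induction k with
    | zero => exact h0
    | succ k ih =>
      have h := hrec k
      rw [ih, map_zero, map_zero, zero_add] at h
      refine (mul_eq_zero.mp h).resolve_left ?_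
      have hc : (2 * (k + 1) * (2 * k + (p - 1) : ℝ[X])) =
          C (2 * (k + 1) * (2 * k + (p - 1) : ℝ)) := by
        simp only [map_mul, map_ofNat, map_add, map_sub, map_natCast, map_one]
      have hp' : (2 : ℝ) ≤ p := by exact_mod_cast hp
      rw [hc, C_eq_zero]
      have : (0 : ℝ) < 2 * (k + 1) * (2 * k + (p - 1)) := by
        have : (0 : ℝ) ≤ k := k.cast_nonneg
        apply mul_pos <;> linarith
      exact this.ne'
  rw [show g = 0 from Polynomial.ext fun k => by simp [hk k], map_zero]

end Uniqueness

/-! ### Legendre polynomials and the Poisson identity -/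

section Generating

open PowerSeries

variable {p : ℕ} [NeZero p]

lemma map_invSqrt_kernelBase_sq_mul {ξ : Fin p → ℝ} (hξ : ξ ⬝ᵥ ξ = 1) :
    map (MvPolynomial.eval ξ) (invSqrt (kernelBase p)) ^ 2 *
      (1 - C (2 * ξ 0) * X + X ^ 2) = 1 := by
  have h := congrArg (map (MvPolynomial.eval ξ))
    (invSqrt_sq_mul (constantCoeff_kernelBase (p := p)))
  have hk : map (MvPolynomial.eval ξ) (kernelBase p) = X ^ 2 - C (2 * ξ 0) * X := by
    simp [kernelBase, eval_normSqPoly, hξ]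
  rw [map_mul, map_pow, map_add, map_one, hk] at h
  linear_combination h

lemma constantCoeff_map_invSqrt_kernelBase (ξ : Fin p → ℝ) :
    constantCoeff (map (MvPolynomial.eval ξ) (invSqrt (kernelBase p))) = 1 := by
  rw [← coeff_zero_eq_constantCoeff_apply, coeff_map, coeff_zero_eq_constantCoeff_apply,
    constantCoeff_invSqrt constantCoeff_kernelBase, map_one]

lemma map_poissonSeries {ξ : Fin p → ℝ} (hξ : ξ ⬝ᵥ ξ = 1) :
    map (MvPolynomial.eval ξ) (poissonSeries p) =
      (1 - X ^ 2) * map (MvPolynomial.eval ξ) (invSqrt (kernelBase p)) ^ p := by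
  simp [poissonSeries, eval_normSqPoly, hξ]

/-- At `η` the Poisson kernel is `(1 - T²) / (1 - T)^p`, whose coefficients are the dimensions of
the spaces of harmonic homogeneous polynomials. -/
lemma eval_northPole_coeff_poissonSeries (n : ℕ) :
    MvPolynomial.eval (northPole p) (coeff n (poissonSeries p)) = harmonicDim p n := by
  have hη : northPole p ⬝ᵥ northPole p = 1 := by simp [northPole_eq_single]
  have hη0 : northPole p 0 = 1 := by simp [northPole_eq_single]
  have hs : map (MvPolynomial.eval (northPole p)) (invSqrt (kernelBase p)) = mk 1 := by
    refine PowerSeries.eq_of_sq_mul_eq_one (map_invSqrt_kernelBase_sq_mul hη) ?_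
      (constantCoeff_map_invSqrt_kernelBase _) (by simp [← coeff_zero_eq_constantCoeff_apply])
    have h := mk_one_mul_one_sub_eq_one ℝ
    rw [hη0, mul_one, map_ofNat]
    linear_combination (mk 1 * (1 - X) + 1) * h
  have hp : p - 1 + 1 = p := Nat.sub_add_cancel (NeZero.one_le)
  have hpow : map (MvPolynomial.eval (northPole p)) (invSqrt (kernelBase p)) ^ p =
      mk fun n => ((p + n - 1).choose n : ℝ) := by
    rw [hs]
    conv_lhs => rw [← hp]
    rw [mk_one_pow_eq_mk_choose_add]
    ext k
    rw [coeff_mk, coeff_mk, Nat.choose_symm_add, show p - 1 + k = p + k - 1 by omega]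
  rw [← coeff_map, map_poissonSeries hη, hpow, sub_mul, one_mul, map_sub, coeff_mk]
  rcases lt_or_ge n 2 with hn | hn
  · rw [harmonicDim_of_lt_two hn, coeff_X_pow_mul', if_neg (by omega), sub_zero]
  · obtain ⟨n, rfl⟩ := Nat.exists_eq_add_of_le' hn
    rw [coeff_X_pow_mul, coeff_mk, ← harmonicDim_add_two]
    push_cast
    ring

lemma harmonicDim_pos (hp : 2 ≤ p) (n : ℕ) : 0 < harmonicDim p n := by
  rcases lt_or_ge n 2 with hn | hn
  · rw [harmonicDim_of_lt_two hn]
    exact Nat.choose_pos (by omega)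
  · obtain ⟨n, rfl⟩ := Nat.exists_eq_add_of_le' hn
    have h := harmonicDim_add_two (p := p) n
    rw [show p + (n + 2) - 1 = p + n - 1 + 1 + 1 by omega, Nat.choose_succ_succ,
      Nat.choose_succ_succ] at h
    have := Nat.choose_pos (n := p + n - 1) (k := n + 1) (by omega)
    simp only [Nat.succ_eq_add_one] at h
    omega

/-- The normalised `n`-th coefficient of the Poisson kernel is the zonal harmonic of degree `n`. -/
lemma isZonalHarmonic_coeff_poissonSeries (hp : 2 ≤ p) (n : ℕ) :
    IsZonalHarmonic p n ((harmonicDim p n : ℝ)⁻¹ • coeff n (poissonSeries p)) := by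
  have h := isZonalSeries_poissonSeries (p := p) n
  have hz := (zonalSubmodule p n).smul_mem (harmonicDim p n : ℝ)⁻¹ h
  refine ⟨⟨hz.1, ?_⟩, ?_, hz.2.1⟩
  · rw [SetLike.mem_coe, LinearMap.mem_ker, map_smul, polyLaplacian_coeff_poissonSeries, smul_zero]
  · have : (harmonicDim p n : ℝ) ≠ 0 := by exact_mod_cast (harmonicDim_pos hp n).ne'
    rw [MvPolynomial.smul_eval, eval_northPole_coeff_poissonSeries, inv_mul_cancel₀ this]

lemma IsZonalHarmonic.unique (hp : 2 ≤ p) {n : ℕ} {L M : MvPolynomial (Fin p) ℝ}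
    (hL : IsZonalHarmonic p n L) (hM : IsZonalHarmonic p n M) : L = M := by
  refine sub_eq_zero.mp (eq_zero_of_eval_northPole_eq_zero hp
    (Submodule.sub_mem _ hL.mem hM.mem) ?_ fun R hR hη x => ?_)
  · rw [map_sub, hL.eval_pole, hM.eval_pole, sub_self]
  · rw [map_sub, map_sub, hL.invariant R hR hη, hM.invariant R hR hη]

lemma exists_unit_apply_zero_eq (hp : 2 ≤ p) {t : ℝ} (ht : t ∈ Set.Icc (-1 : ℝ) 1) :
    ∃ ξ : Fin p → ℝ, ξ ⬝ᵥ ξ = 1 ∧ ξ 0 = t := by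
  have hj : (⟨1, hp⟩ : Fin p) ≠ 0 := by simp [Fin.ext_iff]
  refine ⟨planePoint ⟨1, hp⟩ t √(1 - t ^ 2), ?_, by simp [planePoint]⟩
  rw [planePoint_dotProduct_self hj, Real.sq_sqrt (by nlinarith [ht.1, ht.2])]
  ring

lemma existsUnique_isLegendrePolynomial (hp : 2 ≤ p) (n : ℕ) :
    ∃! P : Polynomial ℝ, IsLegendrePolynomial p n P := by
  have h := isZonalHarmonic_coeff_poissonSeries hp n
  obtain ⟨-, -, P, hP⟩ := (zonalSubmodule p n).smul_mem (harmonicDim p n : ℝ)⁻¹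
    (isZonalSeries_poissonSeries (p := p) n)
  refine ⟨P, ⟨_, h, hP⟩, ?_⟩
  rintro Q ⟨L, hL, hQ⟩
  obtain rfl := hL.unique hp h
  refine Polynomial.eq_of_infinite_eval_eq Q P
    (Set.Infinite.mono ?_ (Set.Icc_infinite (show (-1 : ℝ) < 1 by norm_num)))
  intro t ht
  obtain ⟨ξ, hξ, rfl⟩ := exists_unit_apply_zero_eq hp ht
  have h1 := hQ ξ hξ
  rw [hP ξ hξ, dotProduct_northPole] at h1
  exact h1.symm

lemma harmonicDim_mul_eval_legendrePolynomial (hp : 2 ≤ p) (n : ℕ) {ξ : Fin p → ℝ}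
    (hξ : ξ ⬝ᵥ ξ = 1) :
    harmonicDim p n * (legendrePolynomial p n).eval (ξ 0) =
      MvPolynomial.eval ξ (coeff n (poissonSeries p)) := by
  have hex : ∃ P, IsLegendrePolynomial p n P := (existsUnique_isLegendrePolynomial hp n).exists
  have hspec : IsLegendrePolynomial p n (legendrePolynomial p n) := by
    rw [legendrePolynomial, dif_pos hex]
    exact hex.choose_spec
  obtain ⟨L, hL, hP⟩ := hspec
  obtain rfl := hL.unique hp (isZonalHarmonic_coeff_poissonSeries hp n)
  have h0 : (harmonicDim p n : ℝ) ≠ 0 := by exact_mod_cast (harmonicDim_pos hp n).ne'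
  rw [← dotProduct_northPole ξ, ← hP ξ hξ, MvPolynomial.smul_eval, mul_inv_cancel_left₀ h0]

lemma hasSum_one_sub_sq_mul_pow {r t : ℝ} (hr : |r| < 1) (ht : t ∈ Set.Icc (-1 : ℝ) 1)
    {s : ℝ⟦X⟧} (hs : s ^ 2 * (1 - C (2 * t) * X + X ^ 2) = 1) (hs1 : constantCoeff s = 1) (k : ℕ) :
    HasSum (fun n => coeff n ((1 - X ^ 2) * s ^ k) * r ^ n)
      ((1 - r ^ 2) * (√(1 - 2 * r * t + r ^ 2))⁻¹ ^ k) := by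
  have hsC : map Complex.ofRealHom s ^ 2 * (1 - C (2 * (t : ℂ)) * X + X ^ 2) = 1 := by
    simpa using congrArg (map Complex.ofRealHom) hs
  have hs1C : constantCoeff (map Complex.ofRealHom s) = 1 := by
    rw [← coeff_zero_eq_constantCoeff_apply, coeff_map, coeff_zero_eq_constantCoeff_apply, hs1,
      map_one]
  have hpoly : HasAbsSum (1 - X ^ 2) r (1 - (r : ℂ) ^ 2) := by
    have h := hasAbsSum_coe (1 - Polynomial.X ^ 2 : Polynomial ℂ) r
    rwa [Polynomial.coe_sub, Polynomial.coe_one, Polynomial.coe_pow, Polynomial.coe_X,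
      Polynomial.eval_sub, Polynomial.eval_one, Polynomial.eval_pow, Polynomial.eval_X] at h
  have h := (hpoly.mul ((hasAbsSum_of_sq_mul_eq_one hr ht hsC hs1C).pow k)).2
  have hm : (1 - X ^ 2) * map Complex.ofRealHom s ^ k =
      map Complex.ofRealHom ((1 - X ^ 2) * s ^ k) := by
    simp
  simp only [hm, coeff_map, Complex.ofRealHom_eq_coe] at h
  rw [← Complex.hasSum_ofReal]
  push_cast at h ⊢
  exact h

lemma hasSum_eval_coeff_poissonSeries {r : ℝ} (hr : |r| < 1) {ξ : Fin p → ℝ} (hξ : ξ ⬝ᵥ ξ = 1)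
    (hξ0 : ξ 0 ∈ Set.Icc (-1 : ℝ) 1) :
    HasSum (fun n => MvPolynomial.eval ξ (coeff n (poissonSeries p)) * r ^ n)
      ((1 - r ^ 2) * (√(1 - 2 * r * ξ 0 + r ^ 2))⁻¹ ^ p) := by
  simpa only [← map_poissonSeries hξ, coeff_map] using hasSum_one_sub_sq_mul_pow hr hξ0
    (map_invSqrt_kernelBase_sq_mul hξ) (constantCoeff_map_invSqrt_kernelBase ξ) p

end Generating

theorem mainTheorem9 (p : ℕ) (hp : 2 ≤ p) :
    (∀ n : ℕ, ∃! P : Polynomial ℝ, IsLegendrePolynomial p n P) ∧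
    ∀ r t : ℝ, |r| < 1 → t ∈ Set.Icc (-1 : ℝ) 1 →
      HasSum (fun n : ℕ => r ^ n * (harmonicDim p n : ℝ) * (legendrePolynomial p n).eval t)
        ((1 - r ^ 2) / (1 - 2 * r * t + r ^ 2) ^ ((p : ℝ) / 2)) := by
  have : NeZero p := ⟨by omega⟩
  refine ⟨existsUnique_isLegendrePolynomial hp, fun r t hr ht => ?_⟩
  obtain ⟨ξ, hξ, rfl⟩ := exists_unit_apply_zero_eq hp ht
  have hD : 0 ≤ 1 - 2 * r * ξ 0 + r ^ 2 := by nlinarith [sq_nonneg (r - ξ 0), ht.1, ht.2]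
  convert hasSum_eval_coeff_poissonSeries hr hξ ht using 1
  · funext n
    rw [← harmonicDim_mul_eval_legendrePolynomial hp n hξ]
    ring
  · rw [inv_pow, ← div_eq_mul_inv, Real.sqrt_eq_rpow, ← Real.rpow_mul_natCast hD]
    congr 2
    ring
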